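/- Theorem. Let $d\ge 2$ be an integer and let $f_c(z)=z^d+c$, regarded as a polynomial in $z$ over $\mathbb{Z}[c]$ with $c$ an indeterminate. For a positive integer $m$ let $$\Phi_m^*(z)=\prod_{k\mid m}\bigl(f_c^{\circ k}(z)-z\bigr)^{\mu(m/k)}$$ be the $m$-th dynatomic polynomial of $f_c$, whose degree in $z$ is $d_m=\sum_{k\mid m}d^k\mu(m/k)$, and let the $m$-th multiplier polynomial $\delta_m(x)$ be the monic polynomial in $\mathbb{Z}[c][x]$ with $$\delta_m(x)^m=\prod_{\Phi_m^*(\alpha)=0}\bigl(x-(f_c^{\circ m})'(\alpha)\bigr),$$ where $\alpha$ runs over the roots of $\Phi_m^*$, with multiplicity, in an algebraic closure of $\mathbb{Q}(c)$; such a polynomial exists and is unique. Let $\Phi^{\mathrm{cyc}}_i(x)$ denote the $i$-th cyclotomic polynomial. Then for all positive integers $n,m$ with $m\mid n$ and $m<n$ there is a polynomial $\Psi_{n,m}(t)\in\mathbb{Z}[t]$ such that $$\Delta_{n,m}(c):=\operatorname{Res}_x\bigl(\Phi^{\mathrm{cyc}}_{n/m}(x),\delta_m(x)\bigr)=\Psi_{n,m}\bigl(d^dc^{d-1}\bigr),$$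 and the polynomial $$(-1)^{\varphi(n/m)\left(\frac{d_m}{m}+d_m(d-1)\right)}\,\Psi_{n,m}(t)$$ is monic, where $\varphi$ is Euler's totient function. -/

import Mathlib

open Polynomial

/-- The `k`-fold composition `f ∘ ⋯ ∘ f`, as a polynomial; for `k = 0` it is the variable. -/
noncomputable def iteratePoly {O : Type*} [CommRing O] (f : O[X]) (k : ℕ) : O[X] :=
  f.comp^[k] X

/-- `Φ` is the `n`-th dynatomic polynomial of `f`: in the field of fractions of `O[z]`,
`Φ = ∏_{k ∣ n} (f^{∘k}(z) - z)^{μ(n/k)}`. -/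
def IsDynatomicPolynomial {O : Type*} [CommRing O] [IsDomain O] (f : O[X]) (n : ℕ)
    (Φ : O[X]) : Prop :=
  algebraMap O[X] (FractionRing O[X]) Φ =
    ∏ k ∈ n.divisors,
      algebraMap O[X] (FractionRing O[X]) (iteratePoly f k - X) ^ ArithmeticFunction.moebius (n / k)

/-- The multiplier `ω_n(α) = (f^{∘n})'(α)`, for `α` in an `O`-algebra. -/
noncomputable def multiplier {O : Type*} [CommRing O] {A : Type*} [CommRing A] [Algebra O A]
    (f : O[X]) (n : ℕ) (α : A) : A :=
  aeval α (derivative (iteratePoly f n))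

/-- `δ` is the `n`-th multiplier polynomial of `f`: it is monic and
`δ(x)^n = ∏_{Φ_n^*(α) = 0} (x - ω_n(α))`, where `α` runs over the roots, with multiplicity, of the
`n`-th dynatomic polynomial in an algebraic closure of the field of fractions of `O`. -/
def IsMultiplierPolynomial {O : Type*} [CommRing O] [IsDomain O] (f : O[X]) (n : ℕ)
    (δ : O[X]) : Prop :=
  δ.Monic ∧ ∃ Φ : O[X], IsDynatomicPolynomial f n Φ ∧
    δ.map (algebraMap O (AlgebraicClosure (FractionRing O))) ^ n =
      ((Φ.aroots (AlgebraicClosure (FractionRing O))).map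
        fun α => X - C (multiplier f n α)).prod

/-- `f_c(z) = z^d + c`, a polynomial in `z` over `ℤ[c]`. -/
noncomputable def unicritical (d : ℕ) : ℤ[X][X] :=
  X ^ d + C X

/-- `d_m = ∑_{k ∣ m} d^k μ(m/k)`, the degree of the `m`-th dynatomic polynomial of a polynomial
of degree `d`. It is divisible by `m`. -/
def dynatomicDegree (d m : ℕ) : ℤ :=
  ∑ k ∈ m.divisors, (d : ℤ) ^ k * ArithmeticFunction.moebius (m / k)

/-! Let `K` be algebraically closed and algebraic over ℤ[c], and put b = d^d c^(d-1). The periodic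
points are simple roots of f^k(z) - z, so the roots of the m-th dynatomic polynomial are exactly the
points of exact period m. With T containing one point of each m-cycle, δ_m is the product of x -
ω(z) over z in T.

δ_m has coefficients in ℤ[b]. If l^(d-1) = d, the points y = l z of a cycle satisfy y_i^d = d
y_(i+1) - l^d c with (l^d c)^(d-1) = b. Hence they are integral over ℤ[b], and so is ω, the product
of the y_i^(d-1). An automorphism σ fixing b has σ(c) = c/η with η^(d-1) = 1; then z ↦ η σ(z)
permutes the periodic points and carries ω to σ(ω). Galois descent to the integrally closed ring
ℤ[b] (`exists_multiplierPolynomial_descent`) gives D over ℤ[t] with δ_m = D at t = b, and Ψ =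
Res(Φ^cyc, D).

The leading coefficient is read off at c = ∞. If κ^d = c, then z/κ is integral over ℤ[1/c], which
bounds the degree of the x^k coefficient of D by (|T| - k) m/d
(`natDegree_coeff_multiplierPolynomial_le`). The constant coefficient attains the bound: up to sign
and a power of d it is Φ*_m(0)^(d-1), where Φ*_m(0) is monic of degree d_m/d in c. So it alone
dominates, with leading coefficient ε = ±1. Each D(ζ), for ζ a root of Φ^cyc, then has leading
coefficient ε, and their product Ψ has ε^φ(n/m). -/

/-! ### Integrality along cycles, cycle transversals, roots of powers -/

/-- If `y` is a cyclic sequence with `y i ^ d = a * y (i + 1) - s`, where `d ≥ 2` and `a`, `s` are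
integral over `R`, then its members are integral over `R`. -/
theorem isIntegral_of_cyclic_recurrence {R A : Type*} [CommRing R] [CommRing A] [Nontrivial A]
    [Algebra R A] {d m : ℕ} (hd : 2 ≤ d) (hm : 0 < m) {a s : A} (ha : IsIntegral R a)
    (hs : IsIntegral R s) (y : ℕ → A) (hy : ∀ i, y i ^ d = a * y (i + 1) - s)
    (hper : y m = y 0) : IsIntegral R (y 0) := by
  set B := integralClosure R A
  let a' : B := ⟨a, ha⟩
  let s' : B := ⟨s, hs⟩
  -- Iterating the recurrence expresses a^N y_k as a monic polynomial of degree d^k in y_0. At k = m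
  -- the cycle closes, and P - a^N X is still monic because d^m > 1.
  have key : ∀ k, ∃ (P : B[X]) (N : ℕ), P.Monic ∧ P.natDegree = d ^ k ∧
      aeval (y 0) P = a ^ N * y k := by
    intro k
    induction k with
    | zero => exact ⟨X, 0, monic_X, by simp, by simp⟩
    | succ k ih =>
      obtain ⟨P, N, hP, hdeg, hval⟩ := ih
      have hdeg' : (P ^ d).natDegree = d ^ (k + 1) := by rw [hP.natDegree_pow, hdeg]; ring
      have hpos : 0 < (P ^ d).natDegree := by rw [hdeg']; positivity
      refine ⟨P ^ d + C (a' ^ (d * N) * s'), d * N + 1, ?_, ?_, ?_⟩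
      · exact (hP.pow d).add_of_left (lt_of_le_of_lt degree_C_le
          (natDegree_pos_iff_degree_pos.1 hpos))
      · rw [natDegree_add_C, hdeg']
      · have h1 : algebraMap B A a' = a := rfl
        have h2 : algebraMap B A s' = s := rfl
        simp only [map_add, map_pow, hval, aeval_C, map_mul, h1, h2, mul_pow, hy]
        ring
  obtain ⟨P, N, hP, hdeg, hval⟩ := key m
  have h1 : algebraMap B A a' = a := rfl
  have hdm : 1 < d ^ m := Nat.one_lt_pow hm.ne' hd
  have hlt : (C (a' ^ N) * X).degree < P.degree := by
    refine lt_of_le_of_lt (degree_C_mul_X_le _) ?_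
    rw [degree_eq_natDegree hP.ne_zero, hdeg]
    exact_mod_cast hdm
  have : IsIntegral B (y 0) := by
    refine ⟨P - C (a' ^ N) * X, hP.sub_of_left hlt, ?_⟩
    rw [← aeval_def, map_sub, hval, hper, map_mul, aeval_C, aeval_X, map_pow, h1, sub_self]
  exact isIntegral_trans _ this

/-- A finite set that consists of cycles of length `m` has a transversal for the cycles. -/
theorem exists_cycle_transversal {α : Type*} [DecidableEq α] (F : α → α) {m : ℕ}
    (S : Finset α) (hF : ∀ x ∈ S, F x ∈ S) (hS : ∀ x ∈ S, Function.minimalPeriod F x = m)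
    (hm : 0 < m) :
    ∃ T ⊆ S, ∀ (M : Type) [CommMonoid M] (g : α → M),
      ∏ x ∈ T, ∏ i ∈ Finset.range m, g (F^[i] x) = ∏ x ∈ S, g x := by
  induction S using Finset.strongInduction with
  | H S ih =>
    rcases S.eq_empty_or_nonempty with rfl | ⟨a, ha⟩
    · exact ⟨∅, by simp, by simp⟩
    have hit : ∀ x ∈ S, F^[m] x = x := fun x hx => by
      rw [← hS x hx]; exact Function.iterate_minimalPeriod
    have hiter : ∀ i, F^[i] a ∈ S := by
      intro i
      induction i with
      | zero => exact ha
      | succ i ih => rw [Function.iterate_succ_apply']; exact hF _ ih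
    set O := (Finset.range m).image (fun i => F^[i] a) with hO
    have hOS : O ⊆ S := by
      intro x hx
      obtain ⟨i, -, rfl⟩ := Finset.mem_image.1 hx
      exact hiter i
    have hmem : ∀ i, F^[i] a ∈ O := by
      intro i
      refine Finset.mem_image.2 ⟨i % m, Finset.mem_range.2 (Nat.mod_lt _ hm), ?_⟩
      rw [← hS a ha]
      exact Function.iterate_mod_minimalPeriod_eq
    have haO : a ∈ O := hmem 0
    have hinj : Set.InjOn (fun i => F^[i] a) (Finset.range m) := by
      have := Function.iterate_injOn_Iio_minimalPeriod (f := F) (x := a)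
      rw [hS a ha] at this
      simpa using this
    obtain ⟨T, hT, hprod⟩ := ih (S \ O) (Finset.sdiff_ssubset hOS ⟨a, haO⟩) (by
      intro x hx
      rw [Finset.mem_sdiff] at hx ⊢
      refine ⟨hF x hx.1, fun h => hx.2 ?_⟩
      obtain ⟨i, -, hi⟩ := Finset.mem_image.1 h
      -- From `F x`, a further m - 1 steps lead back to x, so x lies on the orbit of a as soon as `F
      -- x` does.
      have h2 : F^[m - 1 + i] a = x := by
        rw [Function.iterate_add_apply, hi, ← Function.iterate_succ_apply, Nat.succ_eq_add_one,
          Nat.sub_add_cancel hm, hit x hx.1]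
      rw [← h2]
      exact hmem _) (fun x hx => hS x (Finset.sdiff_subset hx))
    have haT : a ∉ T := fun h => (Finset.mem_sdiff.1 (hT h)).2 haO
    refine ⟨insert a T, ?_, ?_⟩
    · exact Finset.insert_subset ha (hT.trans Finset.sdiff_subset)
    · intro M _ g
      rw [Finset.prod_insert haT, hprod, ← Finset.prod_sdiff hOS, mul_comm, hO,
        Finset.prod_image hinj]

/-- Over an integrally closed domain, divisibility of m-th powers implies divisibility of the bases.
This makes δ_m unique and lets its m-th power stand in for it. -/
theorem Polynomial.Monic.eq_of_pow_eq {R : Type*} [CommRing R] [IsDomain R]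
    [IsIntegrallyClosed R[X]] {p q : R[X]} (hp : p.Monic) (hq : q.Monic) {m : ℕ} (hm : m ≠ 0)
    (h : p ^ m = q ^ m) : p = q :=
  eq_of_monic_of_associated hp hq <| associated_of_dvd_dvd
    ((IsIntegrallyClosed.pow_dvd_pow_iff hm).1 h.dvd)
    ((IsIntegrallyClosed.pow_dvd_pow_iff hm).1 h.symm.dvd)

/-! ### Galois descent to ℤ[b], degree at infinity, leading coefficient of a resultant -/

section Descent

/-- Galois descent for integral elements over an integrally closed domain. -/
theorem exists_algebraMap_eq_of_isIntegral_of_fixed {O K : Type*} [CommRing O] [IsDomain O]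
    [IsIntegrallyClosed O] [CharZero O] [Field K] [IsAlgClosed K] [Algebra O K] [FaithfulSMul O K]
    [Algebra.IsAlgebraic O K] {x : K} (hx : IsIntegral O x) (hfix : ∀ σ : K ≃ₐ[O] K, σ x = x) :
    ∃ y, algebraMap O K y = x := by
  let : Algebra (FractionRing O) K := FractionRing.liftAlgebra O K
  have : IsScalarTower O (FractionRing O) K := FractionRing.isScalarTower_liftAlgebra O K
  have : Algebra.IsAlgebraic (FractionRing O) K :=
    (IsFractionRing.comap_isAlgebraic_iff (A := O)).1 inferInstance
  have : CharZero (FractionRing O) := inferInstance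
  have : IsAlgClosure (FractionRing O) K := ⟨inferInstance, inferInstance⟩
  have : Normal (FractionRing O) K := IsAlgClosure.normal _ _
  have : IsGalois (FractionRing O) K := {}
  obtain ⟨y, rfl⟩ := (InfiniteGalois.mem_range_algebraMap_iff_fixed
    (k := FractionRing O) (K := K) x).2 (fun f => hfix (f.restrictScalars O))
  rw [isIntegral_algebraMap_iff (algebraMap (FractionRing O) K).injective] at hx
  obtain ⟨z, rfl⟩ := IsIntegrallyClosed.algebraMap_eq_of_integral hx
  exact ⟨z, IsScalarTower.algebraMap_apply O (FractionRing O) K z⟩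

variable {K : Type*} [Field K]

/-- The subring `ℤ[b]` of the values at `b` of integer polynomials. -/
noncomputable abbrev evalRange (b : K) : Subalgebra ℤ K := (aeval b : ℤ[X] →ₐ[ℤ] K).range

theorem self_mem_evalRange (b : K) : b ∈ evalRange b := ⟨X, by simp⟩

theorem isIntegral_self_evalRange (b : K) : IsIntegral (evalRange b) b :=
  isIntegral_algebraMap (x := (⟨b, self_mem_evalRange b⟩ : evalRange b))

theorem isIntegrallyClosed_evalRange {b : K} (hb : Transcendental ℤ b) :
    IsIntegrallyClosed (evalRange b) := by
  have e : ℤ[X] ≃ₐ[ℤ] (aeval b : ℤ[X] →ₐ[ℤ] K).range :=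
    AlgEquiv.ofInjective _ (transcendental_iff_injective.1 hb)
  exact IsIntegrallyClosed.of_equiv e.toRingEquiv

/-- ℤ[c] lies in the algebraic closure of ℤ[b] in `K`, so transitivity applies. It moves the base
from c to 1/c and to d^d c^(d-1). -/
theorem isAlgebraic_evalRange {b c : K} [Algebra.IsAlgebraic (evalRange c) K]
    (h : IsAlgebraic (evalRange b) c) : Algebra.IsAlgebraic (evalRange b) K := by
  have hle : evalRange c ≤ (Subalgebra.algebraicClosure (evalRange b) K).restrictScalars ℤ := by
    rw [evalRange, ← Algebra.adjoin_singleton_eq_range_aeval]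
    exact Algebra.adjoin_le (by rw [Set.singleton_subset_iff]; exact h)
  have : Algebra.IsAlgebraic (Subalgebra.algebraicClosure (evalRange b) K) K := by
    refine ⟨fun x => ?_⟩
    obtain ⟨p, hp, hx⟩ := Algebra.IsAlgebraic.isAlgebraic (R := evalRange c) x
    let f : evalRange c →+* Subalgebra.algebraicClosure (evalRange b) K :=
      (Subalgebra.inclusion hle).toRingHom
    have hf : Function.Injective f := Subalgebra.inclusion_injective hle
    refine ⟨p.map f, (Polynomial.map_ne_zero_iff hf).2 hp, ?_⟩
    rw [aeval_def, eval₂_map]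
    exact hx
  exact Algebra.IsAlgebraic.trans _ (Subalgebra.algebraicClosure (evalRange b) K) _

theorem map_eq_of_mem_evalRange {b x : K} (hx : x ∈ evalRange b) (σ : K →+* K) (hσ : σ b = b) :
    σ x = x := by
  obtain ⟨p, rfl⟩ := hx
  change σ (aeval b p) = aeval b p
  rw [aeval_def, hom_eval₂, hσ]
  congr 1
  ext
  simp

/-- Galois descent to a polynomial ring `ℤ[b]`, for integral elements. -/
theorem mem_evalRange_of_isIntegral_of_fixed [IsAlgClosed K] [CharZero K] {b : K}
    (hb : Transcendental ℤ b) [Algebra.IsAlgebraic (evalRange b) K] {x : K}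
    (hx : IsIntegral (evalRange b) x) (hfix : ∀ σ : K ≃+* K, σ b = b → σ x = x) :
    x ∈ evalRange b := by
  have := isIntegrallyClosed_evalRange hb
  obtain ⟨y, rfl⟩ := exists_algebraMap_eq_of_isIntegral_of_fixed hx
    (fun σ => hfix σ.toRingEquiv (σ.commutes (⟨b, self_mem_evalRange b⟩ : evalRange b)))
  exact y.2

/-- Galois descent to a polynomial ring `ℤ[b]`, for monic polynomials. -/
theorem exists_map_aeval_eq_of_fixed [IsAlgClosed K] [CharZero K] {b : K}
    (hb : Transcendental ℤ b) [Algebra.IsAlgebraic (evalRange b) K] {p : K[X]}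
    (hp : p.Monic) (hint : ∀ x, p.IsRoot x → IsIntegral (evalRange b) x)
    (hfix : ∀ σ : K ≃+* K, σ b = b → p.map (σ : K →+* K) = p) :
    ∃ P : ℤ[X][X], P.Monic ∧ P.map (aeval b : ℤ[X] →ₐ[ℤ] K).toRingHom = p := by
  have hmem : ∀ i, p.coeff i ∈ Set.range (aeval b : ℤ[X] →ₐ[ℤ] K).toRingHom := fun i =>
    mem_evalRange_of_isIntegral_of_fixed hb (x := p.coeff i)
      (isIntegral_coeff_of_factors p (by rw [hp.leadingCoeff]; exact isIntegral_one)
        (IsAlgClosed.splits p) hint i)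
      (fun σ hσ => by
        conv_rhs => rw [← hfix σ hσ, coeff_map]
        rfl)
  obtain ⟨P, hP, -, hmon⟩ :=
    lifts_and_natDegree_eq_and_monic ((lifts_iff_coeff_lifts p).2 hmem) hp
  exact ⟨P, hmon, hP⟩

/-- If `a(c) / c ^ j` is integral over `ℤ[1 / c]`, then the degree of `a` is at most `j`. -/
theorem natDegree_le_of_isIntegral_evalRange_inv [IsAlgClosed K] [CharZero K] {c : K}
    (hc : Transcendental ℤ c) [Algebra.IsAlgebraic (evalRange c) K] {a : ℤ[X]} {j : ℕ}
    (h : IsIntegral (evalRange c⁻¹) (aeval c a / c ^ j)) : a.natDegree ≤ j := by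
  by_contra! hlt
  have hc0 : c ≠ 0 := fun h => hc (h ▸ isAlgebraic_zero)
  have hci : Transcendental ℤ c⁻¹ := fun h => hc (by simpa using h.inv)
  have : Algebra.IsAlgebraic (evalRange c⁻¹) K :=
    isAlgebraic_evalRange (c := c) (by simpa using (isIntegral_self_evalRange c⁻¹).isAlgebraic.inv)
  obtain ⟨p, hp⟩ := mem_evalRange_of_isIntegral_of_fixed hci h (fun σ hσ => by
    have hσc : σ c = c := by simpa using hσ
    rw [map_div₀, map_pow, hσc]
    congr 1
    exact map_eq_of_mem_evalRange ⟨a, rfl⟩ σ.toRingHom hσc)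
  replace hp : aeval c⁻¹ p = aeval c a / c ^ j := hp
  have hrev : aeval c⁻¹ a.reverse * c ^ a.natDegree = aeval c a := by
    let := invertibleOfNonzero hc0
    have := eval₂_reverse_mul_pow (algebraMap ℤ K) c a
    rwa [invOf_eq_inv] at this
  -- Descent puts a(c)/c^j in ℤ[1/c]. If deg a > j, then X divides the reverse of a, whose constant
  -- term is the leading coefficient of a.
  have heq : p * X ^ (a.natDegree - j) = a.reverse := by
    apply transcendental_iff_injective.1 hci
    rw [map_mul, hp, map_pow, aeval_X, ← hrev, inv_pow]
    obtain ⟨k, hk⟩ := Nat.exists_eq_add_of_lt hlt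
    rw [hk, show j + k + 1 - j = k + 1 by omega]
    field_simp
    ring
  have h0 := congrArg (fun q => q.coeff 0) heq
  simp only [coeff_zero_reverse, mul_coeff_zero, coeff_X_pow] at h0
  rw [if_neg (by omega), mul_zero] at h0
  have : a = 0 := leadingCoeff_eq_zero.1 h0.symm
  rw [this, natDegree_zero] at hlt
  omega

end Descent

/-- Let `p` be monic over `ℤ`, and let the constant coefficient of `q` over `ℤ[t]` have leading
coefficient `ε` and a larger degree than the other coefficients. Then `Res(p, q)` has leading
coefficient `ε ^ deg p`. -/
theorem leadingCoeff_resultant_of_coeff_natDegree_lt {p : ℤ[X]} (hp : p.Monic) {q : ℤ[X][X]}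
    (hq : ∀ k, k ≠ 0 → (q.coeff k).degree < (q.coeff 0).degree) :
    (resultant (p.map C) q).leadingCoeff = (q.coeff 0).leadingCoeff ^ p.natDegree := by
  let f : ℤ →+* ℂ := Int.castRingHom ℂ
  have hf : Function.Injective f := Int.cast_injective
  have hf' : Function.Injective (mapRingHom f) := map_injective f hf
  have hpm : ((p.map C).map (mapRingHom f)) = (p.map f).map C := by
    rw [map_map, map_map]
    congr 1
    ext
    simp
  have hsplit : (p.map f).Splits := IsAlgClosed.splits _
  -- Over ℂ the polynomial p splits, and the resultant becomes the product of the values of q at its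
  -- roots.
  have hres : (resultant (p.map C) q).map f =
      ((p.map f).roots.map fun z => (q.map (mapRingHom f)).eval (C z)).prod := by
    have h1 := resultant_map_map (p.map C) q (p.map C).natDegree q.natDegree (mapRingHom f)
    rw [coe_mapRingHom] at h1
    rw [← h1]
    have h2 := resultant_eq_prod_eval ((p.map f).map C) (q.map (mapRingHom f)) q.natDegree
      natDegree_map_le (hsplit.map C)
    rw [← hpm, hpm, ((hp.map f).map C).leadingCoeff, one_pow, one_mul, hsplit.roots_map C,
      Multiset.map_map] at h2
    rw [natDegree_map_eq_of_injective (C_injective), natDegree_map_eq_of_injective hf] at h2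
    rw [natDegree_map_eq_of_injective (C_injective), hpm, h2]
    rfl
  -- Substituting a constant z does not raise degrees in t, so the constant coefficient dominates
  -- every value of q.
  have hlead : ∀ z : ℂ, ((q.map (mapRingHom f)).eval (C z)).leadingCoeff =
      f (q.coeff 0).leadingCoeff := by
    intro z
    have hne : q.coeff 0 ≠ 0 := fun h => by simpa [h] using hq 1 one_ne_zero
    rw [eval_eq_sum_range, Finset.sum_range_succ', leadingCoeff_add_of_degree_lt]
    · simp [leadingCoeff_map_of_injective hf]
    · simp only [coeff_map, coe_mapRingHom, pow_zero, mul_one]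
      rw [degree_map_eq_of_injective hf]
      refine lt_of_le_of_lt (degree_sum_le _ _) ((Finset.sup_lt_iff (bot_lt_iff_ne_bot.2
        (degree_ne_bot.2 hne))).2 fun k _ => ?_)
      rw [← C_pow, mul_comm]
      refine lt_of_le_of_lt ((degree_mul_le _ _).trans (add_le_of_nonpos_left degree_C_le)) ?_
      rw [degree_map_eq_of_injective hf]
      exact hq _ (Nat.succ_ne_zero k)
  apply hf
  rw [← leadingCoeff_map_of_injective hf, hres, leadingCoeff_multiset_prod, Multiset.map_map,
    map_pow]
  simp only [Function.comp_def, hlead, Multiset.map_const', Multiset.prod_replicate]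
  rw [← hsplit.natDegree_eq_card_roots, natDegree_map_eq_of_injective hf]

/-! ### Iterates of a polynomial and their derivatives -/

section IteratePoly

variable {R S : Type*} [CommRing R] [CommRing S]

theorem iteratePoly_zero (f : R[X]) : iteratePoly f 0 = X := rfl

theorem iteratePoly_succ (f : R[X]) (k : ℕ) :
    iteratePoly f (k + 1) = f.comp (iteratePoly f k) :=
  Function.iterate_succ_apply' _ _ _

theorem map_iteratePoly (φ : R →+* S) (f : R[X]) (k : ℕ) :
    (iteratePoly f k).map φ = iteratePoly (f.map φ) k := by
  induction k with
  | zero => exact map_X φ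
  | succ k ih => rw [iteratePoly_succ, map_comp, ih, iteratePoly_succ]

theorem eval_iteratePoly (f : R[X]) (k : ℕ) (x : R) :
    (iteratePoly f k).eval x = (fun z => f.eval z)^[k] x := by
  induction k with
  | zero => exact eval_X
  | succ k ih => rw [iteratePoly_succ, eval_comp, ih, Function.iterate_succ_apply']

theorem iteratePoly_monic_natDegree [Nontrivial R] {f : R[X]} (hf : f.Monic)
    (hd : f.natDegree ≠ 0) (k : ℕ) :
    (iteratePoly f k).Monic ∧ (iteratePoly f k).natDegree = f.natDegree ^ k := by
  induction k with
  | zero => exact ⟨monic_X, by simp [iteratePoly_zero]⟩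
  | succ k ih =>
    have hne : (iteratePoly f k).natDegree ≠ 0 := by rw [ih.2]; exact pow_ne_zero _ hd
    refine ⟨by rw [iteratePoly_succ]; exact hf.comp ih.1 hne, ?_⟩
    rw [iteratePoly_succ, natDegree_comp_eq_of_mul_ne_zero, ih.2]
    · ring
    · rw [hf.leadingCoeff, ih.1.leadingCoeff]; simp

theorem iteratePoly_sub_X_monic_natDegree [Nontrivial R] {f : R[X]} (hf : f.Monic)
    (hd : 2 ≤ f.natDegree) {k : ℕ} (hk : 0 < k) :
    (iteratePoly f k - X).Monic ∧ (iteratePoly f k - X).natDegree = f.natDegree ^ k := by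
  obtain ⟨h1, h2⟩ := iteratePoly_monic_natDegree hf (by omega) k
  have hlt : (X : R[X]).natDegree < (iteratePoly f k).natDegree := by
    rw [natDegree_X, h2]
    exact Nat.one_lt_pow hk.ne' hd
  exact ⟨h1.sub_of_left (degree_lt_degree hlt), by rw [natDegree_sub_eq_left_of_natDegree_lt hlt, h2]⟩

theorem eval_derivative_iteratePoly (f : R[X]) (k : ℕ) (x : R) :
    (derivative (iteratePoly f k)).eval x =
      ∏ i ∈ Finset.range k, (derivative f).eval ((fun z => f.eval z)^[i] x) := by
  induction k with
  | zero => simp [iteratePoly_zero]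
  | succ k ih =>
    rw [iteratePoly_succ, derivative_comp, eval_mul, ih, eval_comp, eval_iteratePoly,
      Finset.prod_range_succ]

end IteratePoly

/-! ### Periodic points and multipliers of z^d + c -/

/-- The map `z ↦ z ^ d + c`. -/
def unicriticalMap {K : Type*} [Field K] (d : ℕ) (c : K) (z : K) : K := z ^ d + c

/-- The multiplier of a point of period `m` of `z ↦ z ^ d + c`. -/
def unicriticalMultiplier {K : Type*} [Field K] (d : ℕ) (c : K) (m : ℕ) (z : K) : K :=
  ∏ i ∈ Finset.range m, (d * ((unicriticalMap d c)^[i] z) ^ (d - 1))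

/-- The polynomial `z ^ d + c` for a value `c` of the parameter. -/
noncomputable def unicriticalPoly {K : Type*} [Field K] (d : ℕ) (c : K) : K[X] := X ^ d + C c

/-- The set of points of exact period `m` of `z ↦ z ^ d + c`. -/
noncomputable def exactPeriodicPts {K : Type*} [Field K] (d : ℕ) (c : K) (m : ℕ) : Finset K := by
  classical
  exact (iteratePoly (unicriticalPoly d c) m - X).roots.toFinset.filter
    fun z => Function.minimalPeriod (unicriticalMap d c) z = m

section Dynamics

variable {K : Type*} [Field K] {d : ℕ} {c : K}

theorem unicriticalPoly_monic (hd : 2 ≤ d) : (unicriticalPoly d c).Monic :=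
  monic_X_pow_add_C c (by omega)

theorem natDegree_unicriticalPoly : (unicriticalPoly d c).natDegree = d := natDegree_X_pow_add_C

theorem eval_iteratePoly_unicriticalPoly (k : ℕ) (z : K) :
    (iteratePoly (unicriticalPoly d c) k).eval z = (unicriticalMap d c)^[k] z := by
  rw [eval_iteratePoly]
  congr 2
  ext x
  simp [unicriticalPoly, unicriticalMap]

theorem eval_derivative_iteratePoly_unicriticalPoly (k : ℕ) (z : K) :
    (derivative (iteratePoly (unicriticalPoly d c) k)).eval z = unicriticalMultiplier d c k z := by
  rw [eval_derivative_iteratePoly, unicriticalMultiplier]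
  have : (fun z => (unicriticalPoly d c).eval z) = unicriticalMap d c := by
    ext x
    simp [unicriticalPoly, unicriticalMap]
  rw [this]
  refine Finset.prod_congr rfl fun i _ => ?_
  simp [unicriticalPoly, derivative_X_pow]

theorem mem_exactPeriodicPts (hd : 2 ≤ d) {m : ℕ} (hm : 0 < m) {z : K} :
    z ∈ exactPeriodicPts d c m ↔ Function.minimalPeriod (unicriticalMap d c) z = m := by
  classical
  rw [exactPeriodicPts, Finset.mem_filter, Multiset.mem_toFinset, and_iff_right_iff_imp]
  rintro h
  have h1 := iteratePoly_sub_X_monic_natDegree (unicriticalPoly_monic (c := c) hd)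
    (by rwa [natDegree_unicriticalPoly]) hm
  rw [mem_roots h1.1.ne_zero, IsRoot, eval_sub, eval_iteratePoly_unicriticalPoly, eval_X, ← h,
    Function.iterate_minimalPeriod, sub_self]

theorem iterate_eq_of_mem_exactPeriodicPts (hd : 2 ≤ d) {m : ℕ} (hm : 0 < m) {z : K}
    (hz : z ∈ exactPeriodicPts d c m) : (unicriticalMap d c)^[m] z = z := by
  rw [mem_exactPeriodicPts hd hm] at hz
  rw [← hz, Function.iterate_minimalPeriod]

theorem iterate_mem_exactPeriodicPts (hd : 2 ≤ d) {m : ℕ} (hm : 0 < m) {z : K}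
    (hz : z ∈ exactPeriodicPts d c m) (i : ℕ) :
    (unicriticalMap d c)^[i] z ∈ exactPeriodicPts d c m := by
  rw [mem_exactPeriodicPts hd hm] at hz ⊢
  rwa [Function.minimalPeriod_apply_iterate]
  rwa [← Function.minimalPeriod_pos_iff_mem_periodicPts, hz]

/-- Integrality of the rescaled periodic points `l * z`. -/
theorem isIntegral_mul_of_periodic {R : Type*} [CommRing R] [Algebra R K] (hd : 2 ≤ d) {m : ℕ}
    (hm : 0 < m) {l : K} (h1 : IsIntegral R (l ^ (d - 1))) (h2 : IsIntegral R (l ^ d * c)) {z : K}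
    (hz : (unicriticalMap d c)^[m] z = z) : IsIntegral R (l * z) := by
  -- Along the orbit, (l z_i)^d = l^(d-1) (l z_(i+1)) - l^d c.
  refine isIntegral_of_cyclic_recurrence hd hm h1 h2 (fun i => l * (unicriticalMap d c)^[i] z)
    (fun i => ?_) (by simp [hz])
  obtain ⟨e, rfl⟩ := Nat.exists_eq_add_of_le' (show 1 ≤ d by omega)
  rw [Function.iterate_succ_apply', unicriticalMap, Nat.add_sub_cancel]
  ring

/-- Integrality of the rescaled multipliers. -/
theorem isIntegral_mul_prod_of_periodic {R : Type*} [CommRing R] [Algebra R K] (hd : 2 ≤ d) {m : ℕ}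
    (hm : 0 < m) {l : K} (h1 : IsIntegral R (l ^ (d - 1))) (h2 : IsIntegral R (l ^ d * c)) {z : K}
    (hz : z ∈ exactPeriodicPts d c m) :
    IsIntegral R (l ^ (m * (d - 1)) *
      ∏ i ∈ Finset.range m, ((unicriticalMap d c)^[i] z) ^ (d - 1)) := by
  have : l ^ (m * (d - 1)) * ∏ i ∈ Finset.range m, ((unicriticalMap d c)^[i] z) ^ (d - 1) =
      ∏ i ∈ Finset.range m, (l * (unicriticalMap d c)^[i] z) ^ (d - 1) := by
    simp_rw [mul_pow]
    rw [Finset.prod_mul_distrib, Finset.prod_const, Finset.card_range, ← pow_mul, mul_comm m]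
  rw [this]
  exact IsIntegral.prod _ fun i _ => (isIntegral_mul_of_periodic hd hm h1 h2
    (iterate_eq_of_mem_exactPeriodicPts hd hm
      (iterate_mem_exactPeriodicPts hd hm hz i))).pow _

theorem unicriticalMultiplier_eq (m : ℕ) (z : K) : unicriticalMultiplier d c m z =
    (d : K) ^ m * ∏ i ∈ Finset.range m, ((unicriticalMap d c)^[i] z) ^ (d - 1) := by
  rw [unicriticalMultiplier, Finset.prod_mul_distrib, Finset.prod_const, Finset.card_range]

/-- Moving along the cycle only rotates the factors of the multiplier. -/
theorem unicriticalMultiplier_iterate {m : ℕ} {z : K}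
    (hz : (unicriticalMap d c)^[m] z = z) (j : ℕ) :
    unicriticalMultiplier d c m ((unicriticalMap d c)^[j] z) = unicriticalMultiplier d c m z := by
  rcases m.eq_zero_or_pos with rfl | hm
  · simp [unicriticalMultiplier]
  induction j with
  | zero => rfl
  | succ j ih =>
    rw [← ih, Function.iterate_succ_apply']
    set w := (unicriticalMap d c)^[j] z with hw
    have hwm : (unicriticalMap d c)^[m] w = w := by
      rw [hw, ← Function.iterate_add_apply, add_comm, Function.iterate_add_apply, hz]
    obtain ⟨k, rfl⟩ := Nat.exists_eq_add_of_le' (show 1 ≤ m by omega)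
    rw [unicriticalMultiplier, unicriticalMultiplier, Finset.prod_range_succ,
      Finset.prod_range_succ']
    simp only [← Function.iterate_succ_apply]
    rw [hwm, Function.iterate_zero_apply]

/-! ### Twisted Galois action on periodic points -/

section Galois

variable {m : ℕ} {σ : K ≃+* K} {η : K}

/-- Since η^d = η, the map z ↦ η σ(z) commutes with z^d + c, even when σ moves c. -/
theorem unicriticalMap_twist (hd : 2 ≤ d) (hη : η ^ (d - 1) = 1) (hc : η * σ c = c) (z : K) :
    unicriticalMap d c (η * σ z) = η * σ (unicriticalMap d c z) := by
  have : η ^ d = η := by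
    obtain ⟨e, rfl⟩ := Nat.exists_eq_add_of_le' (show 1 ≤ d by omega)
    rw [Nat.add_sub_cancel] at hη
    rw [pow_succ, hη, one_mul]
  rw [unicriticalMap, unicriticalMap, map_add, map_pow, mul_pow, this, mul_add, hc]

theorem iterate_unicriticalMap_twist (hd : 2 ≤ d) (hη : η ^ (d - 1) = 1) (hc : η * σ c = c)
    (i : ℕ) (z : K) :
    (unicriticalMap d c)^[i] (η * σ z) = η * σ ((unicriticalMap d c)^[i] z) := by
  induction i with
  | zero => rfl
  | succ i ih =>
    rw [Function.iterate_succ_apply', ih, unicriticalMap_twist hd hη hc,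
      Function.iterate_succ_apply']

theorem unicriticalMultiplier_twist (hd : 2 ≤ d) (hη : η ^ (d - 1) = 1) (hc : η * σ c = c)
    (z : K) : unicriticalMultiplier d c m (η * σ z) = σ (unicriticalMultiplier d c m z) := by
  rw [unicriticalMultiplier, unicriticalMultiplier, map_prod]
  refine Finset.prod_congr rfl fun i _ => ?_
  rw [iterate_unicriticalMap_twist hd hη hc, mul_pow, hη, one_mul, map_mul, map_pow, map_natCast]

/-- The bijection z ↦ η σ(z) preserves minimal periods and so permutes the factors. It serves the
dynatomic polynomial (η = 1, h the identity) and the multipliers (η = c/σ(c)). -/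
theorem map_prod_exactPeriodicPts (hd : 2 ≤ d) (hm : 0 < m) (hη : η ^ (d - 1) = 1)
    (hc : η * σ c = c) (h : K → K) (hh : ∀ z, h (η * σ z) = σ (h z)) :
    (∏ z ∈ exactPeriodicPts d c m, (X - C (h z))).map (σ : K →+* K) =
      ∏ z ∈ exactPeriodicPts d c m, (X - C (h z)) := by
  have hη0 : η ≠ 0 := fun h => by
    rw [h, zero_pow (by omega)] at hη
    exact zero_ne_one hη
  rw [Polynomial.map_prod]
  refine Finset.prod_equiv (σ.toEquiv.trans (Equiv.mulLeft₀ η hη0)) (fun z => ?_) fun z _ => ?_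
  · rw [mem_exactPeriodicPts hd hm, mem_exactPeriodicPts hd hm]
    have : Function.minimalPeriod (unicriticalMap d c) z =
        Function.minimalPeriod (unicriticalMap d c) (η * σ z) := by
      rw [Function.minimalPeriod_eq_minimalPeriod_iff]
      intro n
      rw [Function.IsPeriodicPt, Function.IsPeriodicPt, Function.IsFixedPt, Function.IsFixedPt,
        iterate_unicriticalMap_twist hd hη hc, mul_right_inj' hη0, σ.injective.eq_iff]
    rw [this]
    rfl
  · simp [hh]

end Galois

theorem map_unicritical (d : ℕ) (c : K) :
    (unicritical d).map (aeval c : ℤ[X] →ₐ[ℤ] K).toRingHom = unicriticalPoly d c := by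
  simp [unicritical, unicriticalPoly]

end Dynamics

theorem unicritical_monic_natDegree (hd : 2 ≤ d) :
    (unicritical d).Monic ∧ (unicritical d).natDegree = d :=
  ⟨monic_X_pow_add_C _ (by omega), natDegree_X_pow_add_C⟩

/-- The constant coefficients form the critical orbit 0, c, c^d + c, ..., in which each step raises
to the d-th power and adds c. -/
theorem monic_natDegree_coeff_zero_iteratePoly (hd : 2 ≤ d) (k : ℕ) :
    ((iteratePoly (unicritical d) (k + 1)).coeff 0).Monic ∧
      ((iteratePoly (unicritical d) (k + 1)).coeff 0).natDegree = d ^ k := by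
  have hsucc : ∀ k, (iteratePoly (unicritical d) (k + 1)).coeff 0 =
      ((iteratePoly (unicritical d) k).coeff 0) ^ d + X := by
    intro k
    rw [iteratePoly_succ, coeff_zero_eq_eval_zero, coeff_zero_eq_eval_zero, eval_comp]
    simp [unicritical]
  induction k with
  | zero =>
    rw [hsucc, iteratePoly_zero, coeff_X_zero, zero_pow (by omega), zero_add, pow_zero]
    exact ⟨monic_X, natDegree_X⟩
  | succ k ih =>
    rw [hsucc]
    have h1 := ih.1.pow d
    have h2 : (((iteratePoly (unicritical d) (k + 1)).coeff 0) ^ d).natDegree = d ^ (k + 1) := by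
      rw [ih.1.natDegree_pow, ih.2]; ring
    have hlt : (X : ℤ[X]).natDegree <
        (((iteratePoly (unicritical d) (k + 1)).coeff 0) ^ d).natDegree := by
      rw [natDegree_X, h2]
      exact Nat.one_lt_pow (Nat.succ_ne_zero k) hd
    exact ⟨h1.add_of_left (degree_lt_degree hlt),
      by rw [natDegree_add_eq_left_of_natDegree_lt hlt, h2]⟩

/-! ### Simplicity of periodic points and the dynatomic polynomials -/

section Dynatomic

variable {K : Type*} [Field K] [IsAlgClosed K] [CharZero K] {d : ℕ} {c : K}

/-- Every automorphism fixes 1/d, so by descent it would lie in ℤ[c], making d a unit of ℤ. -/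
theorem not_isIntegral_inv_natCast (hd : 2 ≤ d) (hc : Transcendental ℤ c)
    [Algebra.IsAlgebraic (evalRange c) K] : ¬ IsIntegral (evalRange c) (d : K)⁻¹ := by
  intro h
  obtain ⟨p, hp⟩ := mem_evalRange_of_isIntegral_of_fixed hc h (fun σ _ => by simp)
  replace hp : aeval c p = (d : K)⁻¹ := hp
  have h1 : C (d : ℤ) * p = 1 := by
    apply transcendental_iff_injective.1 hc
    rw [map_mul, hp, aeval_C, map_one]
    have : (d : K) ≠ 0 := by exact_mod_cast (by omega : d ≠ 0)
    simp [this]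
  have h2 : IsUnit (d : ℤ) := Polynomial.isUnit_C.1 (IsUnit.of_mul_eq_one _ h1)
  have := Int.isUnit_iff.1 h2
  omega

/-- The multiplier is d times an element integral over ℤ[c]; were it 1, that element would be 1/d.
-/
theorem unicriticalMultiplier_ne_one (hd : 2 ≤ d) (hc : Transcendental ℤ c)
    [Algebra.IsAlgebraic (evalRange c) K] {k : ℕ} (hk : 0 < k) {z : K}
    (hz : (unicriticalMap d c)^[k] z = z) : unicriticalMultiplier d c k z ≠ 1 := by
  intro h
  refine not_isIntegral_inv_natCast hd hc ?_
  have hd0 : (d : K) ≠ 0 := by exact_mod_cast (by omega : d ≠ 0)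
  obtain ⟨k, rfl⟩ := Nat.exists_eq_add_of_le' (show 1 ≤ k by omega)
  rw [unicriticalMultiplier_eq, pow_succ', mul_assoc] at h
  rw [← eq_inv_of_mul_eq_one_right h]
  have hint : ∀ i, IsIntegral (evalRange c) ((unicriticalMap d c)^[i] z) := fun i => by
    have := isIntegral_mul_of_periodic (R := evalRange c) (d := d) (c := c) (l := 1) hd hk
      (by simpa using isIntegral_one) (by simpa using isIntegral_self_evalRange c)
      (z := (unicriticalMap d c)^[i] z)
      (by rw [← Function.iterate_add_apply, add_comm, Function.iterate_add_apply, hz])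
    simpa using this
  refine IsIntegral.mul (IsIntegral.pow ?_ _) (IsIntegral.prod _ fun i _ => (hint i).pow _)
  exact isIntegral_algebraMap (x := (d : evalRange c))

/-- At a double root the derivative of f^k(z) - z vanishes, which says that the multiplier is 1. -/
theorem roots_iteratePoly_sub_X_nodup (hd : 2 ≤ d) (hc : Transcendental ℤ c)
    [Algebra.IsAlgebraic (evalRange c) K] {k : ℕ} (hk : 0 < k) :
    (iteratePoly (unicriticalPoly d c) k - X).roots.Nodup := by
  have h0 := (iteratePoly_sub_X_monic_natDegree (unicriticalPoly_monic (c := c) hd)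
    (by rwa [natDegree_unicriticalPoly]) hk).1
  classical
  rw [Multiset.nodup_iff_count_le_one]
  intro z
  rw [count_roots]
  by_contra! hlt
  obtain ⟨hr, hdr⟩ := (one_lt_rootMultiplicity_iff_isRoot h0.ne_zero).1 hlt
  rw [IsRoot, eval_sub, eval_iteratePoly_unicriticalPoly, eval_X, sub_eq_zero] at hr
  rw [IsRoot, derivative_sub, eval_sub, eval_derivative_iteratePoly_unicriticalPoly, derivative_X,
    eval_one, sub_eq_zero] at hdr
  exact unicriticalMultiplier_ne_one hd hc hk hr hdr

theorem prod_exactPeriodicPts_divisors (hd : 2 ≤ d) (hc : Transcendental ℤ c)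
    [Algebra.IsAlgebraic (evalRange c) K] {k : ℕ} (hk : 0 < k) :
    ∏ j ∈ k.divisors, ∏ z ∈ exactPeriodicPts d c j, (X - C z) =
      iteratePoly (unicriticalPoly d c) k - X := by
  classical
  have h0 := (iteratePoly_sub_X_monic_natDegree (unicriticalPoly_monic (c := c) hd)
    (by rwa [natDegree_unicriticalPoly]) hk).1
  have hroots : (iteratePoly (unicriticalPoly d c) k - X).roots.toFinset =
      k.divisors.biUnion (exactPeriodicPts d c) := by
    ext z
    rw [Multiset.mem_toFinset, mem_roots h0.ne_zero, IsRoot, eval_sub,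
      eval_iteratePoly_unicriticalPoly, eval_X, sub_eq_zero, Finset.mem_biUnion]
    change Function.IsPeriodicPt _ _ _ ↔ _
    rw [Function.isPeriodicPt_iff_minimalPeriod_dvd]
    constructor
    · intro h
      exact ⟨_, Nat.mem_divisors.2 ⟨h, hk.ne'⟩,
        (mem_exactPeriodicPts hd (Nat.pos_of_dvd_of_pos h hk)).2 rfl⟩
    · rintro ⟨j, hj, hz⟩
      rw [(mem_exactPeriodicPts hd (Nat.pos_of_mem_divisors hj)).1 hz]
      exact Nat.dvd_of_mem_divisors hj
  rw [← Finset.prod_biUnion, ← hroots, Finset.prod_eq_multiset_prod,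
    Multiset.toFinset_val, Multiset.dedup_eq_self.2 (roots_iteratePoly_sub_X_nodup hd hc hk)]
  · exact ((IsAlgClosed.splits _).eq_prod_roots_of_monic h0).symm
  · intro i hi j hj hij
    rw [Function.onFun, Finset.disjoint_left]
    intro z h1 h2
    rw [mem_exactPeriodicPts hd (Nat.pos_of_mem_divisors hi)] at h1
    rw [mem_exactPeriodicPts hd (Nat.pos_of_mem_divisors hj)] at h2
    exact hij (h1.symm.trans h2)

/-- Möbius inversion; it is applied both to the number of points of exact period and to the degree
of Φ*_m(0). -/
theorem eq_dynatomicDegree_of_sum_divisors {u : ℕ → ℤ}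
    (h : ∀ k > 0, ∑ j ∈ k.divisors, u j = (d : ℤ) ^ k) {m : ℕ} (hm : 0 < m) :
    u m = dynatomicDegree d m := by
  rw [← (ArithmeticFunction.sum_eq_iff_sum_mul_moebius_eq (g := fun k => (d : ℤ) ^ k)).1 h m hm,
    dynatomicDegree]
  simp only [Int.cast_id]
  rw [Nat.sum_divisorsAntidiagonal' (fun x y => (ArithmeticFunction.moebius x : ℤ) * (d : ℤ) ^ y)]
  exact Finset.sum_congr rfl fun k _ => mul_comm _ _

theorem card_exactPeriodicPts (hd : 2 ≤ d) (hc : Transcendental ℤ c)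
    [Algebra.IsAlgebraic (evalRange c) K] {m : ℕ} (hm : 0 < m) :
    ((exactPeriodicPts d c m).card : ℤ) = dynatomicDegree d m := by
  refine eq_dynatomicDegree_of_sum_divisors (u := fun m => ((exactPeriodicPts d c m).card : ℤ))
    (fun k hk => ?_) hm
  have h := congrArg natDegree (prod_exactPeriodicPts_divisors hd hc hk)
  rw [(iteratePoly_sub_X_monic_natDegree (unicriticalPoly_monic (c := c) hd)
    (by rwa [natDegree_unicriticalPoly]) hk).2, natDegree_unicriticalPoly,
    natDegree_prod_of_monic _ _ fun j _ => monic_prod_X_sub_C _ _] at h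
  simp only [natDegree_finsetProd_X_sub_C_eq_card] at h
  exact_mod_cast h

variable (d c) in
/-- A sequence of polynomials over `ℤ[c]` whose `j`-th member has the points of exact period `j`
as its roots. -/
def IsDynatomicSequence (Φ : ℕ → ℤ[X][X]) : Prop :=
  ∀ j > 0, (Φ j).Monic ∧ (Φ j).map (aeval c : ℤ[X] →ₐ[ℤ] K).toRingHom =
    ∏ z ∈ exactPeriodicPts d c j, (X - C z)

theorem exists_isDynatomicSequence (hd : 2 ≤ d) (hc : Transcendental ℤ c)
    [Algebra.IsAlgebraic (evalRange c) K] : ∃ Φ, IsDynatomicSequence d c Φ := by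
  suffices ∀ j, ∃ P : ℤ[X][X], j > 0 → P.Monic ∧
      P.map (aeval c : ℤ[X] →ₐ[ℤ] K).toRingHom = ∏ z ∈ exactPeriodicPts d c j, (X - C z) from
    ⟨fun j => (this j).choose, fun j => (this j).choose_spec⟩
  intro j
  by_cases hj : 0 < j
  · obtain ⟨P, hP⟩ := exists_map_aeval_eq_of_fixed hc
      (p := ∏ z ∈ exactPeriodicPts d c j, (X - C z)) (monic_prod_X_sub_C _ _) (by
        intro x hx
        rw [IsRoot, eval_prod, Finset.prod_eq_zero_iff] at hx
        obtain ⟨z, hz, hzx⟩ := hx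
        rw [eval_sub, eval_X, eval_C, sub_eq_zero] at hzx
        have := isIntegral_mul_of_periodic (R := evalRange c) (d := d) (c := c) (l := 1) hd hj
          (by simpa using isIntegral_one) (by simpa using isIntegral_self_evalRange c)
          (iterate_eq_of_mem_exactPeriodicPts hd hj hz)
        rw [hzx]
        simpa using this)
      (fun σ hσ => map_prod_exactPeriodicPts hd hj (one_pow _) (by rw [hσ, one_mul]) (fun z => z)
        (fun z => one_mul _))
    exact ⟨P, fun _ => hP⟩
  · exact ⟨0, fun h => absurd h hj⟩

variable {Φ : ℕ → ℤ[X][X]}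

theorem IsDynatomicSequence.prod_divisors (hΦ : IsDynatomicSequence d c Φ) (hd : 2 ≤ d)
    (hc : Transcendental ℤ c) [Algebra.IsAlgebraic (evalRange c) K] {k : ℕ} (hk : 0 < k) :
    ∏ j ∈ k.divisors, Φ j = iteratePoly (unicritical d) k - X := by
  have hinj : Function.Injective (aeval c : ℤ[X] →ₐ[ℤ] K).toRingHom :=
    transcendental_iff_injective.1 hc
  apply map_injective _ hinj
  rw [Polynomial.map_prod, Polynomial.map_sub, map_iteratePoly, map_unicritical, map_X,
    ← prod_exactPeriodicPts_divisors hd hc hk]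
  exact Finset.prod_congr rfl fun j hj => (hΦ j (Nat.pos_of_mem_divisors hj)).2

theorem IsDynatomicSequence.isDynatomicPolynomial (hΦ : IsDynatomicSequence d c Φ) (hd : 2 ≤ d)
    (hc : Transcendental ℤ c) [Algebra.IsAlgebraic (evalRange c) K] {m : ℕ} (hm : 0 < m) :
    IsDynatomicPolynomial (unicritical d) m (Φ m) := by
  have hinj := IsFractionRing.injective ℤ[X][X] (FractionRing ℤ[X][X])
  have h := (ArithmeticFunction.prod_eq_iff_prod_pow_moebius_eq_of_nonzero
    (f := fun j => algebraMap ℤ[X][X] (FractionRing ℤ[X][X]) (Φ j))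
    (g := fun k => algebraMap ℤ[X][X] (FractionRing ℤ[X][X]) (iteratePoly (unicritical d) k - X))
    (fun j hj h => (hΦ j hj).1.ne_zero (hinj (by rw [h, map_zero])))
    (fun j hj h => (iteratePoly_sub_X_monic_natDegree (unicritical_monic_natDegree hd).1
      (by rwa [(unicritical_monic_natDegree hd).2]) hj).1.ne_zero (hinj (by rw [h, map_zero])))).1
    (fun k hk => by rw [← map_prod, hΦ.prod_divisors hd hc hk]) m hm
  rw [IsDynatomicPolynomial, ← h, Nat.prod_divisorsAntidiagonal' (fun x y =>
    algebraMap ℤ[X][X] (FractionRing ℤ[X][X]) (iteratePoly (unicritical d) y - X) ^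
      ArithmeticFunction.moebius x)]

/-- Evaluating the product over divisors at z = 0 gives f^k(0), monic in c of degree d^(k-1).
Monicity passes to each factor by induction over proper divisors, and the factor d turns the degree
sums into d^k. -/
theorem IsDynatomicSequence.coeff_zero (hΦ : IsDynatomicSequence d c Φ) (hd : 2 ≤ d)
    (hc : Transcendental ℤ c) [Algebra.IsAlgebraic (evalRange c) K] :
    (∀ j > 0, ((Φ j).coeff 0).Monic) ∧
      ∀ j > 0, (d * ((Φ j).coeff 0).natDegree : ℤ) = dynatomicDegree d j := by
  have hprod : ∀ k > 0, ∏ j ∈ k.divisors, (Φ j).coeff 0 =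
      (iteratePoly (unicritical d) k).coeff 0 := by
    intro k hk
    have := congrArg (eval 0) (hΦ.prod_divisors hd hc hk)
    rw [eval_prod, eval_sub, eval_X, sub_zero] at this
    simpa only [coeff_zero_eq_eval_zero] using this
  have hmonic : ∀ j > 0, ((Φ j).coeff 0).Monic := by
    intro j
    induction j using Nat.strong_induction_on with
    | _ j ih =>
      intro hj
      obtain ⟨k, rfl⟩ := Nat.exists_eq_add_of_le' (show 1 ≤ j by omega)
      have h := hprod (k + 1) hj
      rw [← Nat.insert_self_properDivisors hj.ne',
        Finset.prod_insert Nat.self_notMem_properDivisors] at h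
      refine Monic.of_mul_monic_right (monic_prod_of_monic _ _ fun i hi => ?_)
        (h ▸ (monic_natDegree_coeff_zero_iteratePoly hd k).1)
      exact ih i (Nat.mem_properDivisors.1 hi).2 (Nat.pos_of_mem_properDivisors hi)
  refine ⟨hmonic, fun j hj => ?_⟩
  refine eq_dynatomicDegree_of_sum_divisors
    (u := fun j => (d * ((Φ j).coeff 0).natDegree : ℤ)) (fun k hk => ?_) hj
  have h := congrArg natDegree (hprod k hk)
  rw [natDegree_prod_of_monic _ _ fun j hj => hmonic j (Nat.pos_of_mem_divisors hj)] at h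
  obtain ⟨k, rfl⟩ := Nat.exists_eq_add_of_le' (show 1 ≤ k by omega)
  rw [(monic_natDegree_coeff_zero_iteratePoly hd k).2] at h
  rw [← Finset.mul_sum, pow_succ']
  congr 1
  exact_mod_cast h

end Dynatomic

/-! ### The multiplier polynomial over ℤ[d^d c^(d-1)] and its coefficients -/

section Multiplier

variable {K : Type} [Field K] {d m : ℕ} {c : K}

theorem transcendental_natCast_pow_mul_pow [CharZero K] (hd : 2 ≤ d) (hc : Transcendental ℤ c) :
    Transcendental ℤ ((d : K) ^ d * c ^ (d - 1)) := by
  intro h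
  have hd0 : (d : K) ≠ 0 := by exact_mod_cast (by omega : d ≠ 0)
  have h1 : IsAlgebraic ℤ (d : K) := by
    simpa using isAlgebraic_algebraMap (A := K) (d : ℤ)
  have h2 := (h1.pow d).inv.mul h
  rw [inv_mul_cancel_left₀ (pow_ne_zero _ hd0)] at h2
  exact hc (h2.of_pow (by omega))

theorem isAlgebraic_evalRange_natCast_pow_mul_pow [CharZero K] (hd : 2 ≤ d)
    [Algebra.IsAlgebraic (evalRange c) K] :
    Algebra.IsAlgebraic (evalRange ((d : K) ^ d * c ^ (d - 1))) K := by
  refine isAlgebraic_evalRange (c := c) ?_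
  have hd0 : (d : K) ≠ 0 := by exact_mod_cast (by omega : d ≠ 0)
  have h1 : IsAlgebraic (evalRange ((d : K) ^ d * c ^ (d - 1))) (d : K) :=
    isAlgebraic_algebraMap (d : evalRange ((d : K) ^ d * c ^ (d - 1)))
  have h2 := (h1.pow d).inv.mul (isIntegral_self_evalRange ((d : K) ^ d * c ^ (d - 1))).isAlgebraic
  rw [inv_mul_cancel_left₀ (pow_ne_zero _ hd0)] at h2
  exact h2.of_pow (by omega)

/-- Rescaling by l with l^(d-1) = d absorbs the factor d^m, and (l^d c)^(d-1) = d^d c^(d-1). -/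
theorem isIntegral_unicriticalMultiplier [IsAlgClosed K] (hd : 2 ≤ d) (hm : 0 < m) {z : K}
    (hz : z ∈ exactPeriodicPts d c m) :
    IsIntegral (evalRange ((d : K) ^ d * c ^ (d - 1))) (unicriticalMultiplier d c m z) := by
  obtain ⟨l, hl⟩ := IsAlgClosed.exists_pow_nat_eq (d : K) (show 0 < d - 1 by omega)
  rw [unicriticalMultiplier_eq]
  have := isIntegral_mul_prod_of_periodic (R := evalRange ((d : K) ^ d * c ^ (d - 1))) (l := l)
    hd hm (by rw [hl]; exact isIntegral_algebraMap (x := (d : evalRange _)))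
    (by
      refine IsIntegral.of_pow (show 0 < d - 1 by omega) ?_
      rw [mul_pow, ← pow_mul, mul_comm d, pow_mul, hl]
      exact isIntegral_self_evalRange _) hz
  rwa [mul_comm m, pow_mul, hl] at this

/-- Rescaling by l = 1/κ makes l^d c = 1, while l itself is integral over ℤ[1/c]. -/
theorem isIntegral_unicriticalMultiplier_div (hd : 2 ≤ d) (hm : 0 < m) {κ : K} (hκ : κ ^ d = c)
    (hc0 : c ≠ 0) {z : K} (hz : z ∈ exactPeriodicPts d c m) :
    IsIntegral (evalRange c⁻¹) (unicriticalMultiplier d c m z / κ ^ (m * (d - 1))) := by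
  have hκi : IsIntegral (evalRange c⁻¹) κ⁻¹ := by
    refine IsIntegral.of_pow (show 0 < d by omega) ?_
    rw [inv_pow, hκ]
    exact isIntegral_self_evalRange _
  have := isIntegral_mul_prod_of_periodic (R := evalRange c⁻¹) (l := κ⁻¹) hd hm (hκi.pow _)
    (by rw [inv_pow, hκ, inv_mul_cancel₀ hc0]; exact isIntegral_one) hz
  rw [unicriticalMultiplier_eq, mul_div_assoc, div_eq_inv_mul, ← inv_pow]
  refine IsIntegral.mul (IsIntegral.pow ?_ _) this
  exact isIntegral_algebraMap (x := (d : evalRange c⁻¹))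

variable (d m c) in
/-- A set that contains exactly one point of every cycle of exact period `m`. -/
def IsCycleTransversal (T : Finset K) : Prop :=
  T ⊆ exactPeriodicPts d c m ∧ ∀ (M : Type) [CommMonoid M] (g : K → M),
    ∏ z ∈ T, ∏ i ∈ Finset.range m, g ((unicriticalMap d c)^[i] z) =
      ∏ z ∈ exactPeriodicPts d c m, g z

theorem exists_isCycleTransversal (hd : 2 ≤ d) (hm : 0 < m) :
    ∃ T, IsCycleTransversal d m c T := by
  classical
  exact exists_cycle_transversal (unicriticalMap d c) (exactPeriodicPts d c m)
    (fun x hx => iterate_mem_exactPeriodicPts hd hm hx 1)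
    (fun x hx => (mem_exactPeriodicPts hd hm).1 hx) hm

variable {T : Finset K}

theorem IsCycleTransversal.card_mul (hT : IsCycleTransversal d m c T) :
    T.card * m = (exactPeriodicPts d c m).card := by
  -- With g constantly X, the degrees of the two products count points.
  have h := congrArg natDegree (hT.2 ℤ[X] fun _ => X)
  simp only [Finset.prod_const, Finset.card_range, ← pow_mul, natDegree_X_pow] at h
  rw [← h, mul_comm]

theorem IsCycleTransversal.prod_pow (hT : IsCycleTransversal d m c T) (hd : 2 ≤ d) (hm : 0 < m) :
    (∏ z ∈ T, (X - C (unicriticalMultiplier d c m z))) ^ m =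
      ∏ z ∈ exactPeriodicPts d c m, (X - C (unicriticalMultiplier d c m z)) := by
  rw [← hT.2, ← Finset.prod_pow]
  refine Finset.prod_congr rfl fun z hz => ?_
  simp only [unicriticalMultiplier_iterate (iterate_eq_of_mem_exactPeriodicPts hd hm (hT.1 hz))]
  rw [Finset.prod_const, Finset.card_range]

theorem exists_multiplierPolynomial_descent [IsAlgClosed K] [CharZero K]
    (hd : 2 ≤ d) (hm : 0 < m) (hc : Transcendental ℤ c)
    [Algebra.IsAlgebraic (evalRange c) K] (hT : IsCycleTransversal d m c T) :
    ∃ D : ℤ[X][X], D.Monic ∧ D.map (aeval ((d : K) ^ d * c ^ (d - 1)) : ℤ[X] →ₐ[ℤ] K).toRingHom =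
      ∏ z ∈ T, (X - C (unicriticalMultiplier d c m z)) := by
  have := isAlgebraic_evalRange_natCast_pow_mul_pow (K := K) (c := c) hd
  have hd0 : (d : K) ≠ 0 := by exact_mod_cast (by omega : d ≠ 0)
  have hc0 : c ≠ 0 := fun h => hc (h ▸ isAlgebraic_zero)
  have hmon := monic_prod_X_sub_C (unicriticalMultiplier d c m) T
  refine exists_map_aeval_eq_of_fixed (transcendental_natCast_pow_mul_pow hd hc) hmon ?_ ?_
  · intro x hx
    rw [IsRoot, eval_prod, Finset.prod_eq_zero_iff] at hx
    obtain ⟨z, hz, hzx⟩ := hx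
    rw [eval_sub, eval_X, eval_C, sub_eq_zero] at hzx
    rw [hzx]
    exact isIntegral_unicriticalMultiplier hd hm (hT.1 hz)
  · intro σ hσ
    have hσ0 : σ c ≠ 0 := (map_ne_zero σ).2 hc0
    rw [map_mul, map_pow, map_pow, map_natCast, mul_right_inj' (pow_ne_zero _ hd0)] at hσ
    -- The transversal need not be stable under the twisted action, but the set of all points of
    -- exact period m is. Hence the passage to m-th powers, with η = c/σ(c).
    refine (hmon.map _).eq_of_pow_eq hmon hm.ne' ?_
    rw [← Polynomial.map_pow, hT.prod_pow hd hm]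
    have hη : (c / σ c) ^ (d - 1) = 1 := by
      rw [div_pow, hσ, div_self (pow_ne_zero _ hc0)]
    exact map_prod_exactPeriodicPts hd hm hη (div_mul_cancel₀ _ hσ0) _
      fun z => unicriticalMultiplier_twist hd hη (div_mul_cancel₀ _ hσ0) z

theorem aeval_comp_natCast_pow_mul (c : K) (p : ℤ[X]) :
    aeval c (p.comp ((d : ℤ[X]) ^ d * X ^ (d - 1))) = aeval ((d : K) ^ d * c ^ (d - 1)) p := by
  rw [aeval_comp]
  simp

theorem natDegree_natCast_pow_mul_X_pow (hd : 2 ≤ d) :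
    ((d : ℤ[X]) ^ d * X ^ (d - 1)).natDegree = d - 1 ∧
      ((d : ℤ[X]) ^ d * X ^ (d - 1)).leadingCoeff = (d : ℤ) ^ d := by
  have hd0 : (d : ℤ) ^ d ≠ 0 := pow_ne_zero _ (by omega)
  have : (d : ℤ[X]) ^ d * X ^ (d - 1) = C ((d : ℤ) ^ d) * X ^ (d - 1) := by simp
  rw [this]
  exact ⟨natDegree_C_mul_X_pow _ _ hd0, leadingCoeff_C_mul_X_pow _ _⟩

variable {D : ℤ[X][X]}

theorem natDegree_coeff_multiplierPolynomial_le [IsAlgClosed K] [CharZero K]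
    (hd : 2 ≤ d) (hm : 0 < m)
    (hc : Transcendental ℤ c) [Algebra.IsAlgebraic (evalRange c) K]
    (hT : IsCycleTransversal d m c T)
    (hD : D.map (aeval ((d : K) ^ d * c ^ (d - 1)) : ℤ[X] →ₐ[ℤ] K).toRingHom =
      ∏ z ∈ T, (X - C (unicriticalMultiplier d c m z))) (k : ℕ) :
    d * (D.coeff k).natDegree ≤ (T.card - k) * m := by
  have hc0 : c ≠ 0 := fun h => hc (h ▸ isAlgebraic_zero)
  obtain ⟨κ, hκ⟩ := IsAlgClosed.exists_pow_nat_eq c (show 0 < d by omega)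
  have hκ0 : κ ≠ 0 := fun h => hc0 (by rw [← hκ, h, zero_pow (by omega)])
  set l := κ ^ (m * (d - 1)) with hl
  have hl0 : l ≠ 0 := pow_ne_zero _ hκ0
  set w := ∏ z ∈ T, (X - C (unicriticalMultiplier d c m z / l)) with hw
  have hscale : ∏ z ∈ T, (X - C (unicriticalMultiplier d c m z)) = w.scaleRoots l := by
    rw [hw]
    clear hw w hT hD
    clear_value l
    induction T using Finset.cons_induction with
    | empty => simp
    | cons a s ha ih =>
      rw [Finset.prod_cons, Finset.prod_cons, mul_scaleRoots_of_noZeroDivisors, ← ih,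
        X_sub_C_scaleRoots, div_mul_cancel₀ _ hl0]
  have hwdeg : w.natDegree = T.card := by
    rw [hw, natDegree_finsetProd_X_sub_C_eq_card]
  have hwint : ∀ k, IsIntegral (evalRange c⁻¹) (w.coeff k) := fun k => by
    refine isIntegral_coeff_prod _ _ (fun z hz j => ?_) k
    have := isIntegral_unicriticalMultiplier_div hd hm hκ hc0 (hT.1 hz)
    rw [coeff_sub, coeff_X, coeff_C]
    refine IsIntegral.sub ?_ ?_
    · split_ifs
      exacts [isIntegral_one, isIntegral_zero]
    · split_ifs
      exacts [this, isIntegral_zero]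
  set e := (D.coeff k).comp ((d : ℤ[X]) ^ d * X ^ (d - 1)) with he
  have hval : aeval c e = w.coeff k * l ^ (T.card - k) := by
    rw [he, aeval_comp_natCast_pow_mul, ← hwdeg, ← coeff_scaleRoots, ← hscale, ← hD, coeff_map]
    rfl
  -- The d-th power turns the scaling factor, a power of κ, into a power of c.
  have hbound : (e ^ d).natDegree ≤ m * (d - 1) * (T.card - k) := by
    refine natDegree_le_of_isIntegral_evalRange_inv hc ?_
    have hlc : (l ^ (T.card - k)) ^ d = c ^ (m * (d - 1) * (T.card - k)) := by
      rw [hl, ← hκ]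
      ring
    rw [map_pow, hval, mul_pow, hlc, mul_div_cancel_right₀ _ (pow_ne_zero _ hc0)]
    exact (hwint k).pow d
  rw [natDegree_pow, he, natDegree_comp, (natDegree_natCast_pow_mul_X_pow hd).1] at hbound
  refine Nat.le_of_mul_le_mul_right (c := d - 1) ?_ (by omega)
  linarith

/-- The product of all multipliers over cycles is the product of d z^(d-1) over all points of exact
period m, and Φ*_m(0) is the product of these points up to sign. -/
theorem coeff_zero_multiplierPolynomial (hm : 0 < m)
    (hc : Transcendental ℤ c) {Φ : ℕ → ℤ[X][X]} (hΦ : IsDynatomicSequence d c Φ)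
    (hT : IsCycleTransversal d m c T)
    (hD : D.map (aeval ((d : K) ^ d * c ^ (d - 1)) : ℤ[X] →ₐ[ℤ] K).toRingHom =
      ∏ z ∈ T, (X - C (unicriticalMultiplier d c m z))) :
    (D.coeff 0).comp ((d : ℤ[X]) ^ d * X ^ (d - 1)) =
      C ((-1) ^ (T.card + (exactPeriodicPts d c m).card * (d - 1)) *
        (d : ℤ) ^ (exactPeriodicPts d c m).card) * ((Φ m).coeff 0) ^ (d - 1) := by
  apply transcendental_iff_injective.1 hc
  have h1 : aeval c ((Φ m).coeff 0) =
      (-1) ^ (exactPeriodicPts d c m).card * ∏ z ∈ exactPeriodicPts d c m, z := by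
    have := congrArg (eval 0) (hΦ m hm).2
    rw [← coeff_zero_eq_eval_zero, coeff_map, eval_prod] at this
    simp only [eval_sub, eval_X, eval_C, zero_sub] at this
    rw [Finset.prod_neg] at this
    exact this
  have h2 : aeval ((d : K) ^ d * c ^ (d - 1)) (D.coeff 0) =
      (-1) ^ T.card * ((d : K) ^ (exactPeriodicPts d c m).card *
        (∏ z ∈ exactPeriodicPts d c m, z) ^ (d - 1)) := by
    have := congrArg (eval 0) hD
    rw [← coeff_zero_eq_eval_zero, coeff_map, eval_prod] at this
    simp only [eval_sub, eval_X, eval_C, zero_sub] at this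
    rw [Finset.prod_neg] at this
    simp only [unicriticalMultiplier] at this
    rw [hT.2 K fun z => d * z ^ (d - 1), Finset.prod_mul_distrib, Finset.prod_const,
      Finset.prod_pow] at this
    exact this
  rw [aeval_comp_natCast_pow_mul, h2, map_mul, map_pow, h1, aeval_C, mul_pow, ← pow_mul]
  have h3 : ((-1 : K) ^ ((exactPeriodicPts d c m).card * (d - 1))) *
      (-1) ^ ((exactPeriodicPts d c m).card * (d - 1)) = 1 := by
    rw [← mul_pow]; simp
  simp only [algebraMap_int_eq, eq_intCast, Int.cast_mul, Int.cast_pow, Int.cast_neg, Int.cast_one,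
    Int.cast_natCast, pow_add]
  linear_combination (-(-1) ^ T.card * (d : K) ^ (exactPeriodicPts d c m).card *
        (∏ z ∈ exactPeriodicPts d c m, z) ^ (d - 1)) * h3

theorem natDegree_leadingCoeff_coeff_zero_multiplierPolynomial [IsAlgClosed K] [CharZero K]
    (hd : 2 ≤ d) (hm : 0 < m)
    (hc : Transcendental ℤ c) [Algebra.IsAlgebraic (evalRange c) K]
    (hT : IsCycleTransversal d m c T)
    (hD : D.map (aeval ((d : K) ^ d * c ^ (d - 1)) : ℤ[X] →ₐ[ℤ] K).toRingHom =
      ∏ z ∈ T, (X - C (unicriticalMultiplier d c m z))) :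
    d * (D.coeff 0).natDegree = (exactPeriodicPts d c m).card ∧
      (D.coeff 0).leadingCoeff =
        (-1) ^ (T.card + (exactPeriodicPts d c m).card * (d - 1)) := by
  obtain ⟨Φ, hΦ⟩ := exists_isDynatomicSequence hd hc
  have h := coeff_zero_multiplierPolynomial hm hc hΦ hT hD
  obtain ⟨hmon, hdeg⟩ := hΦ.coeff_zero hd hc
  replace hmon := hmon m hm
  replace hdeg := hdeg m hm
  rw [← card_exactPeriodicPts hd hc hm] at hdeg
  replace hdeg : d * ((Φ m).coeff 0).natDegree = (exactPeriodicPts d c m).card := by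
    exact_mod_cast hdeg
  obtain ⟨hn, hl⟩ := natDegree_natCast_pow_mul_X_pow hd
  set ε : ℤ := (-1) ^ (T.card + (exactPeriodicPts d c m).card * (d - 1)) with hε
  have hd0 : (d : ℤ) ≠ 0 := by omega
  have hne : ε * (d : ℤ) ^ (exactPeriodicPts d c m).card ≠ 0 :=
    mul_ne_zero (pow_ne_zero _ (by norm_num)) (pow_ne_zero _ hd0)
  have h1 : (D.coeff 0).natDegree = ((Φ m).coeff 0).natDegree := by
    have := congrArg natDegree h
    rw [natDegree_comp, hn, natDegree_C_mul hne, hmon.natDegree_pow, mul_comm] at this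
    exact Nat.eq_of_mul_eq_mul_left (by omega) this
  refine ⟨by rw [h1, hdeg], ?_⟩
  -- Substituting d^d c^(d-1) multiplies the leading coefficient by d^(d · deg), which is exactly
  -- the power of d on the right; what remains is the sign.
  have := congrArg leadingCoeff h
  rw [leadingCoeff_comp (by rw [hn]; omega), hl, leadingCoeff_mul, leadingCoeff_C,
    (hmon.pow _).leadingCoeff, mul_one, ← pow_mul, h1, hdeg] at this
  exact mul_right_cancel₀ (pow_ne_zero _ hd0) this

theorem degree_coeff_multiplierPolynomial_lt [IsAlgClosed K] [CharZero K]
    (hd : 2 ≤ d) (hm : 0 < m)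
    (hc : Transcendental ℤ c) [Algebra.IsAlgebraic (evalRange c) K]
    (hT : IsCycleTransversal d m c T) (hmon : D.Monic)
    (hD : D.map (aeval ((d : K) ^ d * c ^ (d - 1)) : ℤ[X] →ₐ[ℤ] K).toRingHom =
      ∏ z ∈ T, (X - C (unicriticalMultiplier d c m z))) {k : ℕ} (hk : k ≠ 0) :
    (D.coeff k).degree < (D.coeff 0).degree := by
  obtain ⟨h1, h2⟩ := natDegree_leadingCoeff_coeff_zero_multiplierPolynomial hd hm hc hT hD
  have hne : D.coeff 0 ≠ 0 := by
    rw [← leadingCoeff_ne_zero, h2]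
    exact pow_ne_zero _ (by norm_num)
  by_cases h0 : D.coeff k = 0
  · rw [h0, degree_zero]
    exact bot_lt_iff_ne_bot.2 (degree_ne_bot.2 hne)
  have hkT : k ≤ T.card := by
    have hdeg := congrArg natDegree hD
    rw [hmon.natDegree_map, natDegree_finsetProd_X_sub_C_eq_card] at hdeg
    rw [← hdeg]
    exact le_natDegree_of_ne_zero h0
  refine degree_lt_degree (Nat.lt_of_mul_lt_mul_left (a := d) ?_)
  rw [h1, ← hT.card_mul]
  refine lt_of_le_of_lt (natDegree_coeff_multiplierPolynomial_le hd hm hc hT hD k) ?_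
  exact Nat.mul_lt_mul_of_pos_right (by omega) hm

end Multiplier

/-! ### The resultant with the cyclotomic polynomial -/

section Main

theorem leadingCoeff_resultant_cyclotomic {D : ℤ[X][X]} {ε : ℤ} (hε : (D.coeff 0).leadingCoeff = ε)
    (hD : ∀ k, k ≠ 0 → (D.coeff k).degree < (D.coeff 0).degree) (r : ℕ) :
    (resultant (cyclotomic r ℤ[X]) D).leadingCoeff = ε ^ r.totient := by
  rw [← map_cyclotomic r (C : ℤ →+* ℤ[X]),
    leadingCoeff_resultant_of_coeff_natDegree_lt (cyclotomic.monic r ℤ) hD, hε, natDegree_cyclotomic]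

/-- Both polynomials are monic and keep their degrees in x under the substitution, so the resultant
commutes with it. -/
theorem resultant_cyclotomic_map_compRingHom {D : ℤ[X][X]} (hD : D.Monic) (r : ℕ) (q : ℤ[X]) :
    resultant (cyclotomic r ℤ[X]) (D.map (compRingHom q)) =
      (resultant (cyclotomic r ℤ[X]) D).comp q := by
  have h := resultant_map_map (cyclotomic r ℤ[X]) D (cyclotomic r ℤ[X]).natDegree D.natDegree
    (compRingHom q)
  rw [map_cyclotomic] at h
  rw [hD.natDegree_map, h]
  rfl

variable {K : Type} [Field K] [Algebra ℤ[X] K]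

theorem algebraMap_eq_aeval : algebraMap ℤ[X] K =
    (aeval (algebraMap ℤ[X] K X) : ℤ[X] →ₐ[ℤ] K).toRingHom := by
  ext
  · simp
  · simp

variable [FaithfulSMul ℤ[X] K]

theorem transcendental_algebraMap_X : Transcendental ℤ (algebraMap ℤ[X] K X) := by
  rw [transcendental_iff_injective]
  have h := FaithfulSMul.algebraMap_injective ℤ[X] K
  rwa [algebraMap_eq_aeval] at h

theorem isAlgebraic_evalRange_algebraMap_X [Algebra.IsAlgebraic ℤ[X] K] :
    Algebra.IsAlgebraic (evalRange (algebraMap ℤ[X] K X)) K := by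
  refine ⟨fun x => ?_⟩
  obtain ⟨p, hp, hx⟩ := Algebra.IsAlgebraic.isAlgebraic (R := ℤ[X]) x
  let f : ℤ[X] →+* evalRange (algebraMap ℤ[X] K X) :=
    (aeval (algebraMap ℤ[X] K X) : ℤ[X] →ₐ[ℤ] K).rangeRestrict.toRingHom
  have hf : Function.Injective f := fun a b hab =>
    transcendental_iff_injective.1 transcendental_algebraMap_X (congrArg Subtype.val hab)
  refine ⟨p.map f, (Polynomial.map_ne_zero_iff hf).2 hp, ?_⟩
  rw [aeval_def, algebraMap_eq_aeval] at hx
  rw [aeval_def, eval₂_map]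
  exact hx

variable (K) in
/-- `δ` is the multiplier polynomial of `z ^ d + c`, computed from the roots of the dynatomic
polynomial in the field `K`. -/
def IsMultiplierPolynomialOver (d m : ℕ) (δ : ℤ[X][X]) : Prop :=
  δ.Monic ∧ ∃ Φ : ℤ[X][X], IsDynatomicPolynomial (unicritical d) m Φ ∧
    δ.map (algebraMap ℤ[X] K) ^ m =
      ((Φ.aroots K).map fun α => X - C (multiplier (unicritical d) m α)).prod

variable [Algebra.IsAlgebraic ℤ[X] K] [IsAlgClosed K] [CharZero K]

/-- The dynatomic polynomial is unique, since ℤ[c][z] embeds in its fraction field, and it has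
simple roots; the multiset of roots is thus the finite set of points of exact period m. -/
theorem isMultiplierPolynomialOver_iff {d m : ℕ} (hd : 2 ≤ d) (hm : 0 < m) (δ : ℤ[X][X]) :
    IsMultiplierPolynomialOver K d m δ ↔ δ.Monic ∧ δ.map (algebraMap ℤ[X] K) ^ m =
      ∏ z ∈ exactPeriodicPts d (algebraMap ℤ[X] K X) m,
        (X - C (unicriticalMultiplier d (algebraMap ℤ[X] K X) m z)) := by
  have := isAlgebraic_evalRange_algebraMap_X (K := K)
  obtain ⟨Φ, hΦ⟩ := exists_isDynatomicSequence hd (transcendental_algebraMap_X (K := K))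
  have hdyn := hΦ.isDynatomicPolynomial hd transcendental_algebraMap_X hm
  have huniq : ∀ P, IsDynatomicPolynomial (unicritical d) m P → P = Φ m := fun P hP =>
    IsFractionRing.injective ℤ[X][X] (FractionRing ℤ[X][X]) (hP.trans hdyn.symm)
  have hroots : (((Φ m).aroots K).map fun α => X - C (multiplier (unicritical d) m α)).prod =
      ∏ z ∈ exactPeriodicPts d (algebraMap ℤ[X] K X) m,
        (X - C (unicriticalMultiplier d (algebraMap ℤ[X] K X) m z)) := by
    rw [aroots_def, algebraMap_eq_aeval, (hΦ m hm).2, roots_prod_X_sub_C,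
      Finset.prod_eq_multiset_prod, ← algebraMap_eq_aeval]
    congr 2
    ext1 z
    rw [multiplier, aeval_def, ← eval_map, ← derivative_map, map_iteratePoly,
      ← eval_derivative_iteratePoly_unicriticalPoly, ← map_unicritical, ← algebraMap_eq_aeval]
  rw [IsMultiplierPolynomialOver, ← hroots]
  refine and_congr_right fun _ => ⟨?_, fun h => ⟨Φ m, hdyn, h⟩⟩
  rintro ⟨P, hP, h⟩
  rwa [huniq P hP] at h

variable (K) in
theorem isMultiplierPolynomialOver_resultant (d : ℕ) (hd : 2 ≤ d)
    (n m : ℕ) (hdvd : m ∣ n) (hlt : m < n) :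
    (∃! δ : ℤ[X][X], IsMultiplierPolynomialOver K d m δ) ∧
    ∀ δ : ℤ[X][X], IsMultiplierPolynomialOver K d m δ →
      ∃ Ψ : ℤ[X],
        resultant (cyclotomic (n / m) ℤ[X]) δ = Ψ.comp ((d : ℤ[X]) ^ d * X ^ (d - 1)) ∧
        (C ((Int.negOnePow ((Nat.totient (n / m) : ℤ) *
            (dynatomicDegree d m / m + dynatomicDegree d m * (d - 1))) : ℤˣ) : ℤ) * Ψ).Monic := by
  have hm : 0 < m := Nat.pos_of_dvd_of_pos hdvd (by omega)
  set c : K := algebraMap ℤ[X] K X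
  have hc : Transcendental ℤ c := transcendental_algebraMap_X
  have : Algebra.IsAlgebraic (evalRange c) K := isAlgebraic_evalRange_algebraMap_X
  obtain ⟨T, hT⟩ := exists_isCycleTransversal (c := c) hd hm
  obtain ⟨D, hmon, hD⟩ := exists_multiplierPolynomial_descent hd hm hc hT
  have hmul : IsMultiplierPolynomialOver K d m
      (D.map (compRingHom ((d : ℤ[X]) ^ d * X ^ (d - 1)))) := by
    refine (isMultiplierPolynomialOver_iff hd hm _).2 ⟨hmon.map _, ?_⟩
    rw [← hT.prod_pow hd hm, ← hD, map_map]
    congr 2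
    ext
    · simp
    · simp [c]
  have huniq : ∀ δ, IsMultiplierPolynomialOver K d m δ →
      δ = D.map (compRingHom ((d : ℤ[X]) ^ d * X ^ (d - 1))) := by
    intro δ hδ
    obtain ⟨h1, h2⟩ := (isMultiplierPolynomialOver_iff hd hm _).1 hδ
    obtain ⟨h3, h4⟩ := (isMultiplierPolynomialOver_iff hd hm _).1 hmul
    exact map_injective _ (FaithfulSMul.algebraMap_injective ℤ[X] K)
      ((h1.map _).eq_of_pow_eq (h3.map _) hm.ne' (h2.trans h4.symm))
  refine ⟨⟨_, hmul, huniq⟩, fun δ hδ => ⟨resultant (cyclotomic (n / m) ℤ[X]) D, ?_, ?_⟩⟩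
  · rw [huniq δ hδ, resultant_cyclotomic_map_compRingHom hmon]
  · have hlead := leadingCoeff_resultant_cyclotomic
      (natDegree_leadingCoeff_coeff_zero_multiplierPolynomial hd hm hc hT hD).2
      (fun k hk => degree_coeff_multiplierPolynomial_lt hd hm hc hT hmon hD hk) (n / m)
    have hexp : (Nat.totient (n / m) : ℤ) *
        (dynatomicDegree d m / m + dynatomicDegree d m * (d - 1)) =
        (((T.card + (exactPeriodicPts d c m).card * (d - 1)) * Nat.totient (n / m) : ℕ) : ℤ) := by
      -- The integer division is exact: d_m/m is the number of m-cycles.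
      have h1 : dynatomicDegree d m / m = T.card := by
        rw [← card_exactPeriodicPts hd hc hm, ← hT.card_mul, Nat.cast_mul,
          Int.mul_ediv_cancel _ (by exact_mod_cast hm.ne')]
      rw [h1, ← card_exactPeriodicPts hd hc hm]
      push_cast [Nat.cast_sub (show 1 ≤ d by omega)]
      ring
    rw [Monic, leadingCoeff_mul, leadingCoeff_C, hlead, hexp, Int.negOnePow_def, zpow_natCast,
      ← pow_mul]
    push_cast
    rw [← mul_pow]
    simp

end Main

theorem theorem1p1 (d : ℕ) (hd : 2 ≤ d) (n m : ℕ) (hdvd : m ∣ n) (hlt : m < n) :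
    (∃! δ : ℤ[X][X], IsMultiplierPolynomial (unicritical d) m δ) ∧
    ∀ δ : ℤ[X][X], IsMultiplierPolynomial (unicritical d) m δ →
      ∃ Ψ : ℤ[X],
        resultant (cyclotomic (n / m) ℤ[X]) δ = Ψ.comp ((d : ℤ[X]) ^ d * X ^ (d - 1)) ∧
        (C ((Int.negOnePow ((Nat.totient (n / m) : ℤ) *
            (dynatomicDegree d m / m + dynatomicDegree d m * (d - 1))) : ℤˣ) : ℤ) * Ψ).Monic := by
  have : Algebra.IsAlgebraic ℤ[X] (AlgebraicClosure (FractionRing ℤ[X])) :=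
    (IsFractionRing.comap_isAlgebraic_iff (K := FractionRing ℤ[X])).2 inferInstance
  have : FaithfulSMul ℤ[X] (AlgebraicClosure (FractionRing ℤ[X])) :=
    FaithfulSMul.trans ℤ[X] (FractionRing ℤ[X]) (AlgebraicClosure (FractionRing ℤ[X]))
  exact isMultiplierPolynomialOver_resultant (AlgebraicClosure (FractionRing ℤ[X])) d hd n m hdvd hlt
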